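/- Let $\mathbb F_q$ be a finite field, let $1\le \ell<m$ be integers, let $V$ be an $m$-dimensional vector space over $\mathbb F_q$, and fix a basis of $V$, which identifies $\bigwedge^m V$ with $\mathbb F_q$. Let $A_1\subset\cdots\subset A_\ell$ be a strictly increasing chain of nonzero subspaces of $V$, put $\alpha_i=\dim A_i$ and $\alpha=(\alpha_1,\dots,\alpha_\ell)$, and let $$\Omega_\alpha(\ell,m)=\{L\subseteq V:\ \dim L=\ell,\ \dim(L\cap A_i)\ge i\ \text{ for } i=1,\dots,\ell\}=\{L_1,\dots,L_n\}.$$ For $f\in\bigwedge^d V$ let $V_f=\{x\in V: f\wedge x=0\}$. For each $j$ choose a nonzero $P_j\in\bigwedge^\ell V$ of the form $P_j=v_\ell\wedge\cdots\wedge v_1$ with $v_i\in A_i$ for all $i$ and $V_{P_j}=L_j$. For $f\in\bigwedge^{m-\ell}V$ let $c_f=(f\wedge P_1,\dots,f\wedge P_n)\in\mathbb F_q^n$, and let the Schubert code be $C_\alpha(\ell,m)=\{c_f: f\in\bigwedge^{m-\ell}V\}$. A codeword has minimum weight if its Hamming weight equals the minimum distance of the code, that is, the least Hamming weight of a nonzero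 codeword. Let $p_1<\cdots<p_u<p_{u+1}=\ell$ be the last positions of the maximal blocks of consecutive integers in $\alpha$; that is, $p_1<\dots<p_u$ are the indices $i<\ell$ with $\alpha_{i+1}-\alpha_i\ge2$, and $p_{u+1}=\ell$. An element $f\in\bigwedge^{m-\ell}V$ is called Schubert decomposable if $f\ne0$, $f=f_1\wedge\cdots\wedge f_{m-\ell}$ for some $f_1,\dots,f_{m-\ell}\in V$, and $$\dim(V_f\cap A_{p_i})=\alpha_{p_i}-p_i\quad\text{for } i=1,\dots,u+1.$$ Assume that $\alpha$ is completely non-consecutive, i.e. $\alpha_{i+1}-\alpha_i\ge2$ for $i=1,\dots,\ell-1$. Then, for any $c\in C_\alpha(\ell,m)$, $$c\ \text{has minimum weight}\iff c=c_h\ \text{for some Schubert decomposable } h\in\textstyle\bigwedge^{m-\ell}V.$$ -/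

import Mathlib

namespace SchubertCode

open Module

variable {F V : Type*} [Field F] [AddCommGroup V] [Module F V]

/-- The annihilator `V_f = {x ∈ V : f ∧ x = 0}` of an element `f` of `⋀^d V`. -/
noncomputable def annihilator {d : ℕ} (f : ⋀[F]^d V) : Submodule F V :=
  LinearMap.ker (LinearMap.mulLeft F (f : ExteriorAlgebra F V) ∘ₗ ExteriorAlgebra.ι F)

/-- `f ∈ ⋀^d V` is decomposable if `f ≠ 0` and `f = f_1 ∧ ⋯ ∧ f_d` for some `f_i ∈ V`. -/
def IsDecomposable {d : ℕ} (f : ⋀[F]^d V) : Prop :=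
  f ≠ 0 ∧ ∃ v : Fin d → V, f = exteriorPower.ιMulti F d v

/-- The dimension sequence `α_i = dim A_i` of a partial flag. The index `i : Fin ℓ` (counted from
`0`) stands for the index `i + 1` of the usual notation `A_1 ⊂ ⋯ ⊂ A_ℓ`. -/
noncomputable def dimSeq {ℓ : ℕ} (A : Fin ℓ → Submodule F V) (i : Fin ℓ) : ℕ :=
  finrank F (A i)

/-- `α` is completely non-consecutive: `α_{i+1} - α_i ≥ 2` for `i = 1, …, ℓ - 1`. -/
def IsCompletelyNonconsecutive {ℓ : ℕ} (α : Fin ℓ → ℕ) : Prop :=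
  ∀ i j : Fin ℓ, (j : ℕ) = i + 1 → α i + 2 ≤ α j

/-- `i` is the last position of one of the maximal blocks of consecutive integers of `α`, i.e.
one of `p_1 < ⋯ < p_u < p_{u+1} = ℓ`: either `i` is the last index, or `α_{i+1} - α_i ≥ 2`. -/
def IsBlockEnd {ℓ : ℕ} (α : Fin ℓ → ℕ) (i : Fin ℓ) : Prop :=
  (i : ℕ) + 1 = ℓ ∨ ∃ j : Fin ℓ, (j : ℕ) = i + 1 ∧ α i + 2 ≤ α j

/-- `f` is Schubert decomposable with respect to the flag `A`: it is decomposable and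
`dim (V_f ∩ A_p) = α_p - p` for every block end `p` (here `p = i + 1`). -/
def IsSchubertDecomposable {ℓ d : ℕ} (A : Fin ℓ → Submodule F V) (f : ⋀[F]^d V) : Prop :=
  IsDecomposable f ∧
    ∀ i, IsBlockEnd (dimSeq A) i →
      finrank F ↥(annihilator f ⊓ A i) + ((i : ℕ) + 1) = dimSeq A i

/-- The Schubert variety `Ω_α(ℓ, m)`: the `ℓ`-dimensional subspaces `L` of `V` such that
`dim (L ∩ A_i) ≥ i` for `i = 1, …, ℓ`. -/
def schubertVariety {ℓ : ℕ} (A : Fin ℓ → Submodule F V) : Set (Submodule F V) :=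
  {L | finrank F L = ℓ ∧ ∀ i : Fin ℓ, (i : ℕ) + 1 ≤ finrank F ↥(L ⊓ A i)}

/-- `P` is a choice of representatives of the points of the Schubert variety: each `P_L` is a
decomposable element `v_ℓ ∧ ⋯ ∧ v_1` of `⋀^ℓ V` with `v_i ∈ A_i` for all `i`, and `L = V_{P_L}`. -/
def IsRepresentatives {ℓ : ℕ} (A : Fin ℓ → Submodule F V)
    (P : schubertVariety A → ⋀[F]^ℓ V) : Prop :=
  ∀ L : schubertVariety A, P L ≠ 0 ∧
    (∃ v : Fin ℓ → V, (∀ i, v i ∈ A i) ∧ P L = exteriorPower.ιMulti F ℓ (fun i => v i.rev)) ∧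
    annihilator (P L) = L

/-- The identification of `⋀^m V` with `F` given by a basis `b = (e_1, …, e_m)` of `V`, under which
`v_1 ∧ ⋯ ∧ v_m` is the determinant of the `v_i` in the basis `b`. It is extended by zero to the
other graded pieces of the exterior algebra. -/
noncomputable def topForm {m : ℕ} (b : Basis (Fin m) F V) : ExteriorAlgebra F V →ₗ[F] F :=
  ExteriorAlgebra.liftAlternating (Pi.single m b.det)

/-- The evaluation map `f ↦ c_f = (f ∧ P_L)_L`. -/
noncomputable def evaluation {ℓ m : ℕ} (b : Basis (Fin m) F V) (A : Fin ℓ → Submodule F V)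
    (P : schubertVariety A → ⋀[F]^ℓ V) : ⋀[F]^(m - ℓ) V →ₗ[F] (schubertVariety A → F) :=
  LinearMap.pi fun L =>
    topForm b ∘ₗ LinearMap.mulRight F (P L : ExteriorAlgebra F V) ∘ₗ (⋀[F]^(m - ℓ) V).subtype

/-- The Schubert code `C_α(ℓ, m)`, the image of the evaluation map. -/
noncomputable def schubertCode {ℓ m : ℕ} (b : Basis (Fin m) F V) (A : Fin ℓ → Submodule F V)
    (P : schubertVariety A → ⋀[F]^ℓ V) : Submodule F (schubertVariety A → F) :=
  LinearMap.range (evaluation b A P)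

/-- The Hamming weight of a word: the number of its nonzero coordinates. -/
noncomputable def weight {ι : Type*} (c : ι → F) : ℕ :=
  {i | c i ≠ 0}.ncard

/-- The minimum distance of a linear code: the least weight of a nonzero codeword. -/
noncomputable def minimumDistance {ι : Type*} (C : Submodule F (ι → F)) : ℕ :=
  sInf {w | ∃ c ∈ C, c ≠ 0 ∧ weight c = w}

end SchubertCode

namespace SchubertCode

open Module

variable {F V : Type*} [Field F] [AddCommGroup V] [Module F V]

/-! An element `f` enters its codeword only through the alternating form `φ(v) = f ∧ v_1 ∧ ⋯ ∧ v_ℓ`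
on tuples from the reversed, hence decreasing, flag `B i = A i.rev`. So count generic tuples instead
of subspaces: `v i ∈ B i`, `v i` in no smaller member of the flag, `φ v ≠ 0`. The span of such a
tuple is a point of the Schubert variety with nonzero coordinate, and a point spanned by one of them
is spanned by exactly `adaptedBasesCard` of them. Hence weight times this constant bounds the number
of generic tuples from above.

If `φ` does not vanish on the product of the `B i`, there are at least `∏ (q^(dim B i) - q^(dim B i
- 1))` generic tuples, by induction on the length of the flag (`prod_le_ncard_genericTuples`). Gaps
of at least 2 in the dimension sequence make equality rigid: it forces `φ` to be, on that product, a
scalar times `∏ μ i (v i)` with functionals `μ i` triangular with respect to the flag.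

Such products are exactly what Schubert decomposable elements give: the wedge of a basis of `⋂ ker μ
i` contracts to a multiple of `∏ μ i (v i)`, and the prescribed dimensions of `V_f ∩ A i` express
triangularity. For these every inequality above is an equality, which yields both the minimum
distance and the equivalence. -/

/-! ### Functionals triangular with respect to a flag. -/

/-- The functionals `μ i` and the vectors `u i ∈ B i` are triangular with respect to the
decreasing flag `B`: `μ i` vanishes on `B j` for `j > i`, and `μ i (u i) ≠ 0`. -/
structure IsAdapted {ι : Type*} [LinearOrder ι] (B : ι → Submodule F V) (μ : ι → Dual F V)
    (u : ι → V) : Prop where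
  mem : ∀ i, u i ∈ B i
  apply_eq_zero : ∀ i j, i < j → ∀ x ∈ B j, μ i x = 0
  apply_ne_zero : ∀ i, μ i (u i) ≠ 0

/-- Triangularity is what turns the determinant form, defined on all tuples, into a product of
functionals on the product of the flag members. -/
theorem det_apply_of_mem {ι : Type*} [LinearOrder ι] [Fintype ι] {B : ι → Submodule F V}
    {μ : ι → Dual F V} (hμ : ∀ i j, i < j → ∀ x ∈ B j, μ i x = 0) {v : ι → V}
    (hv : ∀ i, v i ∈ B i) :
    (Matrix.of fun i j => μ i (v j)).det = ∏ i, μ i (v i) := by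
  rw [Matrix.det_of_isLowerTriangular]
  · rfl
  · intro i j hij
    exact hμ i j hij _ (hv j)

namespace IsAdapted

variable {ι : Type*} [LinearOrder ι] [Fintype ι] {B : ι → Submodule F V} {μ : ι → Dual F V}
  {u : ι → V}

theorem det_ne_zero (h : IsAdapted B μ u) : (Matrix.of fun i j => μ i (u j)).det ≠ 0 := by
  rw [det_apply_of_mem h.apply_eq_zero h.mem]
  exact Finset.prod_ne_zero_iff.2 fun i _ => h.apply_ne_zero i

theorem exists_mem_span (h : IsAdapted B μ u) (y : ι → F) :
    ∃ x ∈ Submodule.span F (Set.range u), ∀ i, μ i x = y i := by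
  set M : Matrix ι ι F := Matrix.of fun i j => μ i (u j)
  have hM : IsUnit M.det := h.det_ne_zero.isUnit
  refine ⟨∑ j, (M⁻¹.mulVec y) j • u j, Submodule.sum_mem _ fun j _ =>
    Submodule.smul_mem _ _ (Submodule.subset_span ⟨j, rfl⟩), fun i => ?_⟩
  have : M.mulVec (M⁻¹.mulVec y) = y := by
    rw [Matrix.mulVec_mulVec, Matrix.mul_nonsing_inv _ hM, Matrix.one_mulVec]
  rw [← congrFun this i, map_sum]
  simp only [map_smul, smul_eq_mul]
  exact Finset.sum_congr rfl fun j _ => mul_comm _ _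

/-- On `B i` the functionals of index below `i` vanish automatically, while those of index at least
`i` are jointly surjective because their vectors `u j` lie in `B i`. Rank-nullity does the rest. -/
theorem finrank_iInf_ker_inf [FiniteDimensional F V] (hB : Antitone B) (h : IsAdapted B μ u)
    (i : ι) :
    finrank F ↥((⨅ j, LinearMap.ker (μ j)) ⊓ B i) + Fintype.card {j // i ≤ j}
      = finrank F (B i) := by
  have h' : IsAdapted (fun j : {j // i ≤ j} => B j) (fun j => μ j) (fun j => u j) :=
    ⟨fun j => h.mem j, fun j k hjk => h.apply_eq_zero j k hjk, fun j => h.apply_ne_zero j⟩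
  set f : B i →ₗ[F] ({j // i ≤ j} → F) :=
    (LinearMap.pi fun j : {j // i ≤ j} => μ j) ∘ₗ (B i).subtype with hf
  have hsurj : LinearMap.range f = ⊤ := by
    rw [LinearMap.range_eq_top]
    intro y
    obtain ⟨x, hx, hxy⟩ := h'.exists_mem_span y
    have hle : Submodule.span F (Set.range fun j : {j // i ≤ j} => u j) ≤ B i := by
      rw [Submodule.span_le]
      rintro _ ⟨j, rfl⟩
      exact hB j.2 (h.mem j)
    exact ⟨⟨x, hle hx⟩, funext hxy⟩
  have hker : (LinearMap.ker f).map (B i).subtype = (⨅ j, LinearMap.ker (μ j)) ⊓ B i := by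
    ext x
    simp only [Submodule.mem_map, LinearMap.mem_ker, Submodule.mem_inf, Submodule.mem_iInf]
    constructor
    · rintro ⟨⟨y, hy⟩, hfy, rfl⟩
      refine ⟨fun j => ?_, hy⟩
      rcases le_or_gt i j with hij | hij
      · exact congrFun hfy ⟨j, hij⟩
      · exact h.apply_eq_zero j i hij y hy
    · rintro ⟨h1, h2⟩
      exact ⟨⟨x, h2⟩, funext fun j => h1 j, rfl⟩
  have := LinearMap.finrank_range_add_finrank_ker f
  rw [hsurj, finrank_top, Module.finrank_pi] at this
  rw [← hker, Submodule.finrank_map_subtype_eq, ← this, add_comm]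

end IsAdapted

/-- An alternating form vanishing as soon as one argument lies in the common kernel of independent
functionals `μ i` is a multiple of their wedge product. -/
theorem exists_eq_mul_det {ι E : Type*} [Fintype ι] [DecidableEq ι] [AddCommGroup E] [Module F E]
    (φ : E [⋀^ι]→ₗ[F] F) (μ : ι → Dual F E) (hμ : Function.Surjective (LinearMap.pi μ))
    (hφ : ∀ v i, (∀ j, μ j (v i) = 0) → φ v = 0) :
    ∃ C : F, ∀ v, φ v = C * (Matrix.of fun i j => μ i (v j)).det := by
  obtain ⟨s, hs⟩ := (LinearMap.pi μ).exists_rightInverse_of_surjective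
    (LinearMap.range_eq_top.2 hμ)
  have hs' : ∀ y i, μ i (s y) = y i := fun y i => congrFun (LinearMap.congr_fun hs y) i
  set ψ := φ.compLinearMap s
  refine ⟨ψ (Pi.basisFun F ι), fun v => ?_⟩
  have h1 : φ v = ψ (fun j i => μ i (v j)) := by
    -- Each `v j - w j` lies in the common kernel, so in the multilinear expansion of `φ (w + (v -
    -- w))` only the term `φ w` survives.
    set w : ι → E := fun j => s (fun i => μ i (v j)) with hw
    have hd : v = w + (v - w) := by abel
    rw [hd, AlternatingMap.map_add_univ, Finset.sum_eq_single Finset.univ]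
    · rw [Finset.piecewise_univ]
      simp only [ψ, AlternatingMap.compLinearMap_apply, ← hd]
      rfl
    · intro t _ ht
      obtain ⟨i, hi⟩ : ∃ i, i ∉ t := by
        by_contra! hcon
        exact ht (Finset.eq_univ_of_forall hcon)
      refine hφ _ i fun j => ?_
      rw [Finset.piecewise_eq_of_notMem _ _ _ hi, Pi.sub_apply, map_sub, hw]
      simp [hs']
    · simp
  rw [h1, DFunLike.congr_fun (ψ.eq_smul_basis_det (Pi.basisFun F ι)) _, AlternatingMap.smul_apply,
    smul_eq_mul, Pi.basisFun_det_apply, ← Matrix.det_transpose]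
  rfl

theorem IsAdapted.eq_zero_of_mem_span {ι : Type*} [Fintype ι] [LinearOrder ι]
    {B : ι → Submodule F V} {μ : ι → Dual F V} {u : ι → V} (h : IsAdapted B μ u) {x : V}
    (hx : x ∈ Submodule.span F (Set.range u)) (hμ : ∀ i, μ i x = 0) : x = 0 := by
  obtain ⟨c, rfl⟩ := (Submodule.mem_span_range_iff_exists_fun F).1 hx
  have : (Matrix.of fun i j => μ i (u j)).mulVec c = 0 := by
    ext i
    have := hμ i
    rw [map_sum] at this
    simp only [map_smul, smul_eq_mul] at this
    rw [Pi.zero_apply, ← this]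
    exact Finset.sum_congr rfl fun j _ => mul_comm _ _
  rw [Matrix.eq_zero_of_mulVec_eq_zero h.det_ne_zero this]
  simp

/-- The relative form on a subspace `X` serves both for a single point of the Schubert variety (`X`
its span) and for the whole space (`X = ⊤`). -/
theorem IsAdapted.exists_eq_mul_prod {ι : Type*} [Fintype ι] [LinearOrder ι]
    {B : ι → Submodule F V} {μ : ι → Dual F V} {u : ι → V} (h : IsAdapted B μ u)
    (φ : V [⋀^ι]→ₗ[F] F) (X : Submodule F V) (hX : ∀ i, u i ∈ X)
    (hφ : ∀ v i, (∀ j, v j ∈ X) → (∀ j, μ j (v i) = 0) → φ v = 0) :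
    ∃ C : F, (∀ v, (∀ i, v i ∈ X) → φ v = C * (Matrix.of fun i j => μ i (v j)).det) ∧
      ∀ v, (∀ i, v i ∈ X) → (∀ i, v i ∈ B i) → φ v = C * ∏ i, μ i (v i) := by
  obtain ⟨C, hC⟩ := exists_eq_mul_det (φ.compLinearMap X.subtype) (fun i => μ i ∘ₗ X.subtype)
    (fun y => by
      obtain ⟨x, hx, hxy⟩ := h.exists_mem_span y
      have hle : Submodule.span F (Set.range u) ≤ X := by
        rw [Submodule.span_le]
        rintro _ ⟨j, rfl⟩
        exact hX j
      exact ⟨⟨x, hle hx⟩, funext hxy⟩)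
    (fun v i hv => hφ (fun j => v j) i (fun j => (v j).2) hv)
  have hC' : ∀ v, (∀ i, v i ∈ X) → φ v = C * (Matrix.of fun i j => μ i (v j)).det :=
    fun v hv => hC fun i => ⟨v i, hv i⟩
  refine ⟨C, hC', fun v hv hvB => ?_⟩
  rw [hC' v hv, det_apply_of_mem h.apply_eq_zero hvB]

/-- Functionals adapted to the flag `B` and to given vectors `u i`, vanishing on `W`. -/
theorem exists_isAdapted {n : ℕ} {B : Fin n → Submodule F V} (hB : Antitone B)
    (W : Submodule F V) {u : Fin n → V} (hu : ∀ i, u i ∈ B i) (huW : ∀ i, u i ∉ W)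
    (huB : ∀ i j, i < j → u i ∉ W ⊔ B j) :
    ∃ μ : Fin n → Dual F V, IsAdapted B μ u ∧ ∀ i, W ≤ LinearMap.ker (μ i) := by
  have key : ∀ i, ∃ f : Dual F V, f (u i) ≠ 0 ∧ W ≤ LinearMap.ker f ∧
      ∀ j, i < j → B j ≤ LinearMap.ker f := by
    intro i
    -- Since `B` decreases, killing `W ⊔ B (i + 1)` suffices; for the last index only `W` remains.
    by_cases hi : (i : ℕ) + 1 < n
    · obtain ⟨f, hf, hle⟩ := Submodule.exists_le_ker_of_notMem
        (huB i ⟨i + 1, hi⟩ (Fin.lt_def.2 (Nat.lt_succ_self _)))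
      refine ⟨f, hf, le_sup_left.trans hle, fun j hj => (hB ?_).trans (le_sup_right.trans hle)⟩
      exact Fin.le_def.2 (Nat.succ_le_of_lt hj)
    · obtain ⟨f, hf, hle⟩ := Submodule.exists_le_ker_of_notMem (huW i)
      refine ⟨f, hf, hle, fun j hj => absurd (Fin.lt_def.1 hj) ?_⟩
      have := j.2
      omega
  choose μ h1 h2 h3 using key
  exact ⟨μ, ⟨hu, fun i j hij x hx => h3 i j hij hx, h1⟩, h2⟩

theorem exists_isAdapted_of_not_le {n : ℕ} {B : Fin n → Submodule F V} (hB : Antitone B)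
    (W : Submodule F V) (hW : ∀ i, ¬ B i ≤ W) (hWB : ∀ i j, i < j → ¬ B i ≤ W ⊔ B j) :
    ∃ (μ : Fin n → Dual F V) (u : Fin n → V), IsAdapted B μ u ∧ ∀ i, W ≤ LinearMap.ker (μ i) := by
  have key : ∀ i, ∃ u ∈ B i, u ∉ W ∧ ∀ j, i < j → u ∉ W ⊔ B j := by
    intro i
    by_cases hi : (i : ℕ) + 1 < n
    · obtain ⟨u, hu, huW⟩ := Set.not_subset.1
        (hWB i ⟨i + 1, hi⟩ (Fin.lt_def.2 (Nat.lt_succ_self _)))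
      refine ⟨u, hu, fun h => huW (le_sup_left (b := B _) h), fun j hj h => huW ?_⟩
      exact sup_le_sup_left (hB (Fin.le_def.2 (Nat.succ_le_of_lt hj))) _ h
    · obtain ⟨u, hu, huW⟩ := Set.not_subset.1 (hW i)
      refine ⟨u, hu, huW, fun j hj => absurd (Fin.lt_def.1 hj) ?_⟩
      have := j.2
      omega
  choose u h1 h2 h3 using key
  obtain ⟨μ, h⟩ := exists_isAdapted hB W h1 h2 h3
  exact ⟨μ, u, h⟩

/-! ### Counting generic tuples. -/

theorem ncard_eq_sum_ncard_fiber {α β : Type*} [Finite α] {s : Set α} {t : Finset β} {f : α → β}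
    (h : ∀ a ∈ s, f a ∈ t) : s.ncard = ∑ x ∈ t, {a | a ∈ s ∧ f a = x}.ncard := by
  classical
  have := Fintype.ofFinite α
  rw [Set.ncard_eq_toFinset_card', Finset.card_eq_sum_card_fiberwise (f := f) (t := t)
    (fun a ha => h a (by simpa using ha))]
  refine Finset.sum_congr rfl fun x _ => ?_
  rw [Set.ncard_eq_toFinset_card']
  congr 1
  ext a
  simp

/-- The tuples with `v i ∈ B i` that lie in no smaller member of the flag and on which `φ` does
not vanish. -/
def genericTuples {n : ℕ} (φ : V [⋀^Fin n]→ₗ[F] F) (B : Fin n → Submodule F V) :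
    Set (Fin n → V) :=
  {v | (∀ i, v i ∈ B i) ∧ (∀ i j, i < j → v i ∉ B j) ∧ φ v ≠ 0}

/-- The number of vectors of `W` outside a hyperplane of `W`. -/
noncomputable def hyperplaneComplCard (W : Submodule F V) : ℕ :=
  Nat.card F ^ finrank F W - Nat.card F ^ (finrank F W - 1)

section Finite

variable [Finite V]

theorem ncard_submodule (W : Submodule F V) :
    (W : Set V).ncard = Nat.card F ^ finrank F W := by
  rw [← Module.natCard_eq_pow_finrank (K := F) (V := W)]
  rfl

theorem ncard_diff_submodule (W K : Submodule F V) :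
    ((W : Set V) \ K).ncard = Nat.card F ^ finrank F W - Nat.card F ^ finrank F ↥(W ⊓ K) := by
  rw [← ncard_submodule, ← ncard_submodule, ← Set.ncard_sdiff (by simp) (Set.toFinite _)]
  congr 1
  ext x
  simp

theorem ncard_apply_ne_zero (W : Submodule F V) (f : Dual F V) {u : V} (hu : u ∈ W)
    (hfu : f u ≠ 0) : {x | x ∈ W ∧ f x ≠ 0}.ncard = hyperplaneComplCard W := by
  have h : IsAdapted (fun _ : Unit => W) (fun _ => f) (fun _ => u) :=
    ⟨fun _ => hu, fun i j hij => absurd hij (by simp), fun _ => hfu⟩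
  have h1 := h.finrank_iInf_ker_inf (fun _ _ _ => le_rfl) ()
  rw [iInf_const, Fintype.card_eq_one_iff_nonempty_unique.2 ⟨⟨⟨⟨(), le_rfl⟩⟩, fun _ => rfl⟩⟩] at h1
  have h2 := ncard_diff_submodule W (LinearMap.ker f)
  rw [inf_comm, show finrank F ↥(LinearMap.ker f ⊓ W) = finrank F W - 1 by omega] at h2
  exact h2

theorem ncard_apply_ne_zero_pi {ι : Type*} [LinearOrder ι] [Fintype ι] {B : ι → Submodule F V}
    {μ : ι → Dual F V} {u : ι → V} (h : IsAdapted B μ u) :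
    {v : ι → V | ∀ i, v i ∈ B i ∧ μ i (v i) ≠ 0}.ncard = ∏ i, hyperplaneComplCard (B i) := by
  have h1 : {v : ι → V | ∀ i, v i ∈ B i ∧ μ i (v i) ≠ 0}
      = Set.univ.pi fun i => {x | x ∈ B i ∧ μ i x ≠ 0} := by
    ext v
    simp
  rw [h1, ← Nat.card_coe_set_eq, Nat.card_congr (Equiv.Set.univPi _), Nat.card_pi]
  exact Finset.prod_congr rfl fun i _ => ncard_apply_ne_zero _ _ (h.mem i) (h.apply_ne_zero i)

/-- The conditions `v i ∉ B j` become automatic, because `μ i` kills `B j` for `j > i`. Genericity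
is then the independent requirement `μ i (v i) ≠ 0` in each coordinate. -/
theorem ncard_genericTuples_of_eq_mul_prod {n : ℕ} {φ : V [⋀^Fin n]→ₗ[F] F}
    {B : Fin n → Submodule F V} {μ : Fin n → Dual F V} {u : Fin n → V} (h : IsAdapted B μ u)
    {c : F} (hc : c ≠ 0) (hφ : ∀ v, (∀ i, v i ∈ B i) → φ v = c * ∏ i, μ i (v i)) :
    (genericTuples φ B).ncard = ∏ i, hyperplaneComplCard (B i) := by
  rw [← ncard_apply_ne_zero_pi h]
  congr 1
  ext v
  constructor
  · rintro ⟨h1, -, h3⟩ i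
    rw [hφ v h1] at h3
    exact ⟨h1 i, Finset.prod_ne_zero_iff.1 (right_ne_zero_of_mul h3) i (Finset.mem_univ i)⟩
  · intro hv
    refine ⟨fun i => (hv i).1, fun i j hij hj => (hv i).2 (h.apply_eq_zero i j hij _ hj), ?_⟩
    rw [hφ v fun i => (hv i).1]
    exact mul_ne_zero hc (Finset.prod_ne_zero_iff.2 fun i _ => (hv i).2)

variable [Finite F]

theorem one_lt_card : 1 < Nat.card F := Finite.one_lt_card

theorem hyperplaneComplCard_pos {W : Submodule F V} (hW : W ≠ ⊥) : 0 < hyperplaneComplCard W := by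
  have : finrank F W ≠ 0 := by rwa [Ne, Submodule.finrank_eq_zero]
  exact Nat.sub_pos_of_lt (Nat.pow_lt_pow_right one_lt_card (by omega))

end Finite

/-! ### The lower bound and its equality case. -/

/-- The vectors `x` whose contraction with `φ` vanishes on the product of the `B (i + 1)`. -/
def contractionKernel {n : ℕ} (φ : V [⋀^Fin (n + 1)]→ₗ[F] F) (B : Fin (n + 1) → Submodule F V) :
    Submodule F V where
  carrier := {x | ∀ v : Fin n → V, (∀ i, v i ∈ B i.succ) → φ.curryLeft x v = 0}
  add_mem' {x y} hx hy v hv := by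
    rw [map_add, AlternatingMap.add_apply, hx v hv, hy v hv, add_zero]
  zero_mem' v _ := by rw [map_zero, AlternatingMap.zero_apply]
  smul_mem' t x hx v hv := by rw [map_smul, AlternatingMap.smul_apply, hx v hv, smul_zero]

theorem mem_contractionKernel {n : ℕ} {φ : V [⋀^Fin (n + 1)]→ₗ[F] F}
    {B : Fin (n + 1) → Submodule F V} {x : V} : x ∈ contractionKernel φ B ↔
      ∀ v : Fin n → V, (∀ i, v i ∈ B i.succ) → φ.curryLeft x v = 0 := Iff.rfl

theorem apply_eq_curryLeft {n : ℕ} (φ : V [⋀^Fin (n + 1)]→ₗ[F] F) (v : Fin (n + 1) → V) :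
    φ v = φ.curryLeft (v 0) (Fin.tail v) := by
  rw [AlternatingMap.curryLeft_apply_apply]
  exact congrArg φ (Fin.cons_self_tail v).symm

/-- Suppose the kernel `K` had codimension at most 1 in `B 0`, and take `x ∈ B 1` outside `K`, so
that `B 0 = (B 0 ⊓ K) + F x`. For `y = k + t x` in `B 1`, alternation gives `φ(x, y, …) = φ(x, k, …)
= -φ(k, x, …) = 0`, as `k ∈ K` and `x ∈ B 1`. This puts `x` in `K`, a contradiction. -/
theorem finrank_contractionKernel_inf [FiniteDimensional F V] {n : ℕ}
    (φ : V [⋀^Fin (n + 2)]→ₗ[F] F) {B : Fin (n + 2) → Submodule F V} (hB : Antitone B)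
    (h : ¬ B 1 ≤ contractionKernel φ B) :
    finrank F ↥(B 0 ⊓ contractionKernel φ B) + 2 ≤ finrank F (B 0) := by
  set K := contractionKernel φ B
  obtain ⟨x, hx1, hxK⟩ := Set.not_subset.1 h
  have h10 : B 1 ≤ B 0 := hB (Fin.zero_le 1)
  by_contra! hlt
  have hle : B 0 ⊓ K ⊔ Submodule.span F {x} ≤ B 0 :=
    sup_le inf_le_left ((Submodule.span_singleton_le_iff_mem _ _).2 (h10 hx1))
  have hlt' : B 0 ⊓ K < B 0 ⊓ K ⊔ Submodule.span F {x} := by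
    refine lt_of_le_of_ne le_sup_left fun heq => hxK ?_
    have : x ∈ B 0 ⊓ K := heq ▸ Submodule.mem_sup_right (Submodule.mem_span_singleton_self x)
    exact this.2
  have heq : B 0 ⊓ K ⊔ Submodule.span F {x} = B 0 := by
    refine Submodule.eq_of_le_of_finrank_le hle ?_
    have := Submodule.finrank_lt_finrank_of_lt hlt'
    omega
  refine hxK fun v hv => ?_
  have hv0 : v 0 ∈ B 1 := hv 0
  obtain ⟨k, hk, y, hy, hky⟩ := Submodule.mem_sup.1 (heq.symm ▸ h10 hv0)
  obtain ⟨t, rfl⟩ := Submodule.mem_span_singleton.1 hy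
  set w := Fin.tail v
  have hkw : ∀ z, z ∈ B 1 → (φ.curryLeft k).curryLeft z w = 0 := by
    intro z hz
    rw [AlternatingMap.curryLeft_apply_apply]
    refine hk.2 _ fun i => ?_
    refine Fin.cases ?_ (fun i => ?_) i
    · exact hz
    · exact hv i.succ
  have hsame : ∀ z, (φ.curryLeft z).curryLeft z w = 0 := fun z => by
    rw [AlternatingMap.curryLeft_same, AlternatingMap.zero_apply]
  have hswap : (φ.curryLeft x).curryLeft k w = 0 := by
    have h1 := hsame (x + k)
    simp only [map_add, AlternatingMap.curryLeft_add, LinearMap.add_apply,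
      AlternatingMap.add_apply, hsame, hkw x hx1] at h1
    simpa using h1
  rw [apply_eq_curryLeft, ← hky, map_add, map_smul, AlternatingMap.add_apply,
    AlternatingMap.smul_apply, hsame, hswap, smul_zero, add_zero]

section Finite

variable [Finite V]

theorem ncard_genericTuples_succ {n : ℕ} (φ : V [⋀^Fin (n + 1)]→ₗ[F] F)
    (B : Fin (n + 1) → Submodule F V) (D : Finset V)
    (hD : ∀ x, x ∈ D ↔ x ∈ B 0 ∧ x ∉ contractionKernel φ B ∧ ∀ j : Fin n, x ∉ B j.succ) :
    (genericTuples φ B).ncard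
      = ∑ x ∈ D, (genericTuples (φ.curryLeft x) fun i => B i.succ).ncard := by
  rw [ncard_eq_sum_ncard_fiber (f := fun v => v 0) (t := D)]
  · refine Finset.sum_congr rfl fun x hx => ?_
    obtain ⟨h0, -, hj⟩ := (hD x).1 hx
    rw [← Set.ncard_image_of_injective (f := fun v : Fin n → V => (Fin.cons x v : Fin (n + 1) → V))
      _ (Fin.cons_right_injective (α := fun _ => V) x)]
    congr 1
    ext v
    constructor
    · rintro ⟨⟨h1, h2, h3⟩, rfl⟩
      refine ⟨Fin.tail v, ⟨fun i => h1 i.succ, fun i j hij => h2 _ _ (Fin.succ_lt_succ_iff.2 hij),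
        ?_⟩, Fin.cons_self_tail v⟩
      rwa [← apply_eq_curryLeft]
    · rintro ⟨w, ⟨h1, h2, h3⟩, rfl⟩
      refine ⟨⟨Fin.cases h0 h1, fun i => ?_, h3⟩, rfl⟩
      refine Fin.cases (fun j => ?_) (fun i j => ?_) i
      · refine Fin.cases (fun h => absurd h (lt_irrefl _)) (fun j _ => hj j) j
      · refine Fin.cases (fun h => absurd h (Fin.not_lt_zero _)) (fun j h => ?_) j
        exact h2 i j (Fin.succ_lt_succ_iff.1 h)
  · rintro v ⟨h1, h2, h3⟩
    refine (hD _).2 ⟨h1 0, fun hK => h3 ?_, fun j => h2 0 _ (Fin.succ_pos j)⟩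
    rw [apply_eq_curryLeft]
    exact hK _ fun i => h1 i.succ

variable [Finite F]

/-- With `a = dim W`, the two removed subspaces have at most `q^(a-2)` elements each and share `0`,
so fewer than `2 q^(a-2) ≤ q^(a-1)` vectors are lost. -/
theorem hyperplaneComplCard_lt_ncard {W W' K : Submodule F V} (hW' : finrank F W' + 2 ≤ finrank F W)
    (hK : finrank F ↥(W ⊓ K) + 2 ≤ finrank F W) :
    hyperplaneComplCard W < {x | x ∈ W ∧ x ∉ K ∧ x ∉ W'}.ncard := by
  have h1 := Set.ncard_union_add_ncard_inter (W' : Set V) (W ⊓ K : Submodule F V)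
  have h2 : 0 < ((W' : Set V) ∩ (W ⊓ K : Submodule F V)).ncard :=
    (Set.ncard_pos).2 ⟨0, W'.zero_mem, (W ⊓ K).zero_mem⟩
  have h3 : (W : Set V).ncard ≤ ({x | x ∈ W ∧ x ∉ K ∧ x ∉ W'} ∪
      ((W' : Set V) ∪ (W ⊓ K : Submodule F V))).ncard := by
    refine Set.ncard_le_ncard (fun x hx => ?_) (Set.toFinite _)
    simp only [SetLike.mem_coe] at hx
    simp only [Set.mem_union, Set.mem_ofPred_eq, SetLike.mem_coe, Submodule.mem_inf]
    tauto
  have h4 := Set.ncard_union_le {x | x ∈ W ∧ x ∉ K ∧ x ∉ W'}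
      ((W' : Set V) ∪ (W ⊓ K : Submodule F V))
  rw [ncard_submodule, ncard_submodule] at h1
  rw [ncard_submodule] at h3
  have hq : 1 < Nat.card F := one_lt_card
  have h5 : Nat.card F ^ finrank F W' ≤ Nat.card F ^ (finrank F W - 2) :=
    Nat.pow_le_pow_right (by omega) (by omega)
  have h6 : Nat.card F ^ finrank F ↥(W ⊓ K) ≤ Nat.card F ^ (finrank F W - 2) :=
    Nat.pow_le_pow_right (by omega) (by omega)
  have h7 : 2 * Nat.card F ^ (finrank F W - 2) ≤ Nat.card F ^ (finrank F W - 1) := by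
    rw [show finrank F W - 1 = (finrank F W - 2) + 1 by omega, pow_succ, mul_comm]
    exact Nat.mul_le_mul_left _ hq
  have h8 : Nat.card F ^ (finrank F W - 1) ≤ Nat.card F ^ finrank F W :=
    Nat.pow_le_pow_right (by omega) (by omega)
  unfold hyperplaneComplCard
  omega

/-- A lower bound for the number of generic tuples, with a characterization of equality. -/
theorem prod_le_ncard_genericTuples {n : ℕ} (B : Fin n → Submodule F V) (hB : Antitone B)
    (hgap : ∀ i j : Fin n, (j : ℕ) = i + 1 → finrank F (B j) + 2 ≤ finrank F (B i))
    (φ : V [⋀^Fin n]→ₗ[F] F) (hφ : ∃ v, (∀ i, v i ∈ B i) ∧ φ v ≠ 0) :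
    ∏ i, hyperplaneComplCard (B i) ≤ (genericTuples φ B).ncard ∧
      ((genericTuples φ B).ncard ≤ ∏ i, hyperplaneComplCard (B i) →
        ∃ (μ : Fin n → Dual F V) (u : Fin n → V) (c : F), IsAdapted B μ u ∧ c ≠ 0 ∧
          ∀ v, (∀ i, v i ∈ B i) → φ v = c * ∏ i, μ i (v i)) := by
  induction n with
  | zero =>
    obtain ⟨v, -, hv⟩ := hφ
    refine ⟨?_, fun _ => ⟨finZeroElim, finZeroElim, φ v, ⟨finZeroElim, finZeroElim, finZeroElim⟩,
      hv, fun w _ => ?_⟩⟩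
    · rw [Finset.univ_eq_empty, Finset.prod_empty, Nat.one_le_iff_ne_zero, ← Nat.pos_iff_ne_zero,
        Set.ncard_pos]
      exact ⟨v, finZeroElim, finZeroElim, hv⟩
    · rw [Finset.univ_eq_empty, Finset.prod_empty, mul_one, Subsingleton.elim w v]
  | succ n ih =>
    set K := contractionKernel φ B with hK
    set N := ∏ i : Fin n, hyperplaneComplCard (B i.succ) with hN
    have hprod : ∏ i, hyperplaneComplCard (B i) = hyperplaneComplCard (B 0) * N :=
      Fin.prod_univ_succ _
    obtain ⟨v, hvB, hv⟩ := hφ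
    have hv0K : v 0 ∉ K := fun h => hv (by
      rw [apply_eq_curryLeft]
      exact h _ fun i => hvB i.succ)
    have hbot : ∀ i, B i ≠ ⊥ := fun i hi => hv <| φ.map_coord_zero i <| by
      simpa [hi] using hvB i
    have hNpos : 0 < N := Finset.prod_pos fun i _ => hyperplaneComplCard_pos (hbot _)
    set S : Set V := {x | x ∈ B 0 ∧ x ∉ K ∧ ∀ j : Fin n, x ∉ B j.succ} with hS
    have hcard : (Set.toFinite S).toFinset.card = S.ncard :=
      (Set.ncard_eq_toFinset_card S (Set.toFinite S)).symm
    have hD := ncard_genericTuples_succ φ B (Set.toFinite S).toFinset (fun x => by simp [hS, hK])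
    have hIH : ∀ x ∉ K, _ := fun x hx => ih (fun i => B i.succ)
      (fun i j hij => hB (Fin.succ_le_succ_iff.2 hij))
      (fun i j hij => hgap _ _ (by simp [hij])) (φ.curryLeft x) (by
        have := mem_contractionKernel.not.1 hx
        push Not at this
        exact this)
    have hsum : S.ncard * N ≤ (genericTuples φ B).ncard := by
      rw [hD, ← hcard, ← smul_eq_mul]
      refine Finset.card_nsmul_le_sum _ _ _ fun x hx => (hIH x ?_).1
      exact ((Set.Finite.mem_toFinset _).1 hx).2.1
    rw [hprod]
    -- If the smaller members lie in `K`, avoiding them is automatic and the admissible first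
    -- entries are `B 0` minus a proper subspace. Otherwise two subspaces of codimension at least 2
    -- are removed, and the bound is strict.
    by_cases hle : ∀ j : Fin n, B j.succ ≤ K
    · have hSeq : S = (B 0 : Set V) \ K := by
        ext x
        simp only [hS, Set.mem_ofPred_eq, Set.mem_sdiff, SetLike.mem_coe]
        exact ⟨fun h => ⟨h.1, h.2.1⟩, fun h => ⟨h.1, h.2, fun j hj => h.2 (hle j hj)⟩⟩
      have hSc := ncard_diff_submodule (B 0) K
      rw [← hSeq] at hSc
      have hlt : finrank F ↥(B 0 ⊓ K) < finrank F (B 0) :=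
        Submodule.finrank_lt_finrank_of_lt <| lt_of_le_of_ne inf_le_left fun h =>
          hv0K (h.symm ▸ hvB 0 : v 0 ∈ B 0 ⊓ K).2
      have hq : 1 < Nat.card F := one_lt_card
      have hSge : hyperplaneComplCard (B 0) ≤ S.ncard := by
        rw [hSc]
        exact Nat.sub_le_sub_left (Nat.pow_le_pow_right (by omega) (by omega)) _
      refine ⟨(Nat.mul_le_mul_right N hSge).trans hsum, fun hT => ?_⟩
      have hSle : S.ncard ≤ hyperplaneComplCard (B 0) :=
        Nat.le_of_mul_le_mul_right (hsum.trans hT) hNpos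
      have hcodim : finrank F (B 0) ≤ finrank F ↥(B 0 ⊓ K) + 1 := by
        have h1 : Nat.card F ^ finrank F ↥(B 0 ⊓ K) < Nat.card F ^ finrank F (B 0) :=
          Nat.pow_lt_pow_right hq hlt
        have h2 : Nat.card F ^ (finrank F (B 0) - 1) < Nat.card F ^ finrank F (B 0) :=
          Nat.pow_lt_pow_right hq (by omega)
        rw [hSc, hyperplaneComplCard] at hSle
        have h3 : Nat.card F ^ (finrank F (B 0) - 1) ≤ Nat.card F ^ finrank F ↥(B 0 ⊓ K) := by
          omega
        have := (Nat.pow_le_pow_iff_right hq).1 h3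
        omega
      have hv0S : v 0 ∈ (Set.toFinite S).toFinset := by
        rw [Set.Finite.mem_toFinset, hSeq]
        exact ⟨hvB 0, hv0K⟩
      -- At least `hyperplaneComplCard (B 0)` fibres have at least `N` elements each, so minimality
      -- of the total leaves no fibre larger than `N`.
      have hTv : (genericTuples (φ.curryLeft (v 0)) fun i => B i.succ).ncard ≤ N := by
        by_contra! hlt'
        have : ∑ x ∈ (Set.toFinite S).toFinset, N <
            ∑ x ∈ (Set.toFinite S).toFinset,
              (genericTuples (φ.curryLeft x) fun i => B i.succ).ncard :=
          Finset.sum_lt_sum (fun x hx => (hIH x ((Set.Finite.mem_toFinset _).1 hx).2.1).1)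
            ⟨v 0, hv0S, hlt'⟩
        rw [← hD, Finset.sum_const, hcard, smul_eq_mul] at this
        exact absurd (this.trans_le hT) (not_lt.2 (Nat.mul_le_mul_right N hSge))
      obtain ⟨μ, u, c, hμ, hc, hφv⟩ := (hIH _ hv0K).2 hTv
      obtain ⟨f, hf, hfK⟩ := Submodule.exists_le_ker_of_notMem hv0K
      have hB0 : B 0 ⊓ K ⊔ Submodule.span F {v 0} = B 0 := by
        refine Submodule.eq_of_le_of_finrank_le
          (sup_le inf_le_left ((Submodule.span_singleton_le_iff_mem _ _).2 (hvB 0))) ?_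
        have : B 0 ⊓ K < B 0 ⊓ K ⊔ Submodule.span F {v 0} := by
          refine lt_of_le_of_ne le_sup_left fun heq => hv0K ?_
          have : v 0 ∈ B 0 ⊓ K :=
            heq ▸ Submodule.mem_sup_right (Submodule.mem_span_singleton_self _)
          exact this.2
        have := Submodule.finrank_lt_finrank_of_lt this
        omega
      -- Modulo `K`, a first entry in `B 0` is `t • v 0`, and `f` reads off `t * f (v 0)`; the
      -- inverse in the scalar compensates for `f (v 0)`.
      refine ⟨Fin.cons f μ, Fin.cons (v 0) u, (f (v 0))⁻¹ * c, ⟨?_, fun i j => ?_, ?_⟩,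
        mul_ne_zero (inv_ne_zero hf) hc, fun w hw => ?_⟩
      · exact Fin.cases (hvB 0) hμ.mem
      · refine Fin.cases ?_ (fun i => ?_) i
        · refine Fin.cases (fun h => absurd h (lt_irrefl _)) (fun j _ x hx => ?_) j
          exact hfK (hle j hx)
        · refine Fin.cases (fun h => absurd h (Fin.not_lt_zero _)) (fun j h x hx => ?_) j
          exact hμ.apply_eq_zero i j (Fin.succ_lt_succ_iff.1 h) x hx
      · exact Fin.cases hf hμ.apply_ne_zero
      · obtain ⟨k, hk, y, hy, hky⟩ := Submodule.mem_sup.1 (hB0.symm ▸ hw 0)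
        obtain ⟨t, rfl⟩ := Submodule.mem_span_singleton.1 hy
        have hfk : f k = 0 := hfK hk.2
        rw [apply_eq_curryLeft, Fin.prod_univ_succ, ← hky, map_add, map_smul,
          AlternatingMap.add_apply, AlternatingMap.smul_apply,
          hk.2 (Fin.tail w) fun i => hw i.succ,
          hφv (Fin.tail w) fun i => hw i.succ]
        simp only [Fin.cons_zero, Fin.cons_succ, map_add, map_smul, hfk, zero_add, smul_eq_mul,
          Fin.tail]
        field_simp
    · push Not at hle
      obtain ⟨j, hj⟩ := hle
      obtain ⟨n, rfl⟩ : ∃ k, n = k + 1 := ⟨n - 1, by have := j.2; omega⟩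
      have h1K : ¬ B 1 ≤ K := fun h => hj ((hB (Fin.succ_le_succ_iff.2 (Fin.zero_le j))).trans h)
      have hlt := hyperplaneComplCard_lt_ncard (hgap 0 1 rfl)
        (finrank_contractionKernel_inf φ hB h1K)
      have hSeq : {x | x ∈ B 0 ∧ x ∉ contractionKernel φ B ∧ x ∉ B 1} = S := by
        ext x
        refine ⟨fun h => ⟨h.1, h.2.1, fun j hj => h.2.2 ?_⟩, fun h => ⟨h.1, h.2.1, h.2.2 0⟩⟩
        exact hB (Fin.succ_le_succ_iff.2 (Fin.zero_le j)) hj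
      rw [hSeq] at hlt
      have := ((Nat.mul_lt_mul_right hNpos).2 hlt).trans_le hsum
      exact ⟨this.le, fun h => absurd h (not_le.2 this)⟩

end Finite

/-! ### From generic tuples to points of the Schubert variety. -/

theorem linearIndependent_of_apply_ne_zero {ι : Type*} [Finite ι] {φ : V [⋀^ι]→ₗ[F] F}
    {v : ι → V} (h : φ v ≠ 0) : LinearIndependent F v := by
  by_contra hv
  exact h (φ.map_linearDependent v hv)

theorem apply_ne_zero_of_span_eq {ι : Type*} [Finite ι] {φ : V [⋀^ι]→ₗ[F] F} {v w : ι → V}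
    (hv : φ v ≠ 0) (hw : LinearIndependent F w)
    (h : Submodule.span F (Set.range w) = Submodule.span F (Set.range v)) : φ w ≠ 0 := by
  set L := Submodule.span F (Set.range w) with hL
  have hvL : ∀ i, v i ∈ L := fun i => h ▸ Submodule.subset_span ⟨i, rfl⟩
  have hne : φ.compLinearMap L.subtype ≠ 0 := fun h0 => hv <| by
    simpa using DFunLike.congr_fun h0 fun i => ⟨v i, hvL i⟩
  have := (AlternatingMap.map_basis_ne_zero_iff (Basis.span hw) _).2 hne
  intro h0
  refine this ?_
  rw [AlternatingMap.compLinearMap_apply, ← h0]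
  congr 1
  ext i
  simp [Basis.span_apply]

theorem span_eq_of_linearIndependent [FiniteDimensional F V] {n : ℕ} {w : Fin n → V}
    (hw : LinearIndependent F w) {L : Submodule F V} (hL : finrank F L = n) (hwL : ∀ i, w i ∈ L) :
    Submodule.span F (Set.range w) = L := by
  refine Submodule.eq_of_le_of_finrank_le (Submodule.span_le.2 ?_) ?_
  · rintro _ ⟨i, rfl⟩
    exact hwL i
  · rw [finrank_span_eq_card hw, Fintype.card_fin, hL]

theorem exists_isAdapted_of_mem_genericTuples {n : ℕ} {B : Fin n → Submodule F V}
    (hB : Antitone B) {φ : V [⋀^Fin n]→ₗ[F] F} {v : Fin n → V} (hv : v ∈ genericTuples φ B) :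
    ∃ μ, IsAdapted B μ v := by
  obtain ⟨μ, hμ, -⟩ := exists_isAdapted hB ⊥ hv.1
    (fun i => (linearIndependent_of_apply_ne_zero hv.2.2).ne_zero i)
    (fun i j hij => by rw [bot_sup_eq]; exact hv.2.1 i j hij)
  exact ⟨μ, hμ⟩

theorem IsAdapted.inf {ι : Type*} [LinearOrder ι] {B : ι → Submodule F V} {μ : ι → Dual F V}
    {u : ι → V} (h : IsAdapted B μ u) {L : Submodule F V} (hL : ∀ i, u i ∈ L) :
    IsAdapted (fun i => L ⊓ B i) μ u :=
  ⟨fun i => ⟨hL i, h.mem i⟩, fun i j hij x hx => h.apply_eq_zero i j hij x hx.2, h.apply_ne_zero⟩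

theorem card_subtype_fin_le {n : ℕ} (i : Fin n) : Fintype.card {j // i ≤ j} = n - i := by
  rw [Fintype.card_subtype, ← Fin.card_Ici]
  congr 1
  ext j
  simp

/-- The common kernel of the `μ i` meets the span of `v` trivially, so `finrank_iInf_ker_inf`,
applied to the flag cut down to that span, leaves only the number of indices at least `i`. -/
theorem IsAdapted.finrank_span_inf [FiniteDimensional F V] {n : ℕ} {B : Fin n → Submodule F V}
    (hB : Antitone B) {μ : Fin n → Dual F V} {v : Fin n → V} (h : IsAdapted B μ v) (i : Fin n) :
    finrank F ↥(Submodule.span F (Set.range v) ⊓ B i) = n - i := by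
  have h0 := h.inf (L := Submodule.span F (Set.range v)) fun i => Submodule.subset_span ⟨i, rfl⟩
  have h1 := h0.finrank_iInf_ker_inf
    (fun i j hij => inf_le_inf_left _ (hB hij)) i
  have h2 : (⨅ j, LinearMap.ker (μ j)) ⊓ (Submodule.span F (Set.range v) ⊓ B i) = ⊥ := by
    rw [eq_bot_iff]
    rintro x ⟨hx1, hx2, -⟩
    exact h.eq_zero_of_mem_span hx2 fun j => (Submodule.mem_iInf _).1 hx1 j
  rw [h2, finrank_bot, zero_add, card_subtype_fin_le] at h1
  exact h1.symm

/-- The number of bases of an `n`-dimensional space adapted to a given complete flag. -/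
noncomputable def adaptedBasesCard (F : Type*) (n : ℕ) : ℕ :=
  ∏ i : Fin n, (Nat.card F ^ (n - i) - Nat.card F ^ (n - i - 1))

section Finite

variable [Finite V] {n : ℕ} {B : Fin n → Submodule F V} {φ : V [⋀^Fin n]→ₗ[F] F}

/-- On the `n`-dimensional span `L`, `φ` is a nonzero multiple of `det (μ i (v j))`. The product
count therefore applies to the complete flag `L ⊓ B i`, whose dimensions are `n - i`, and the answer
depends neither on `L` nor on `φ`. -/
theorem ncard_genericTuples_span_eq (hB : Antitone B) {v : Fin n → V}
    (hv : v ∈ genericTuples φ B) :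
    {w | w ∈ genericTuples φ B ∧
        Submodule.span F (Set.range w) = Submodule.span F (Set.range v)}.ncard
      = adaptedBasesCard F n := by
  obtain ⟨μ, hμ⟩ := exists_isAdapted_of_mem_genericTuples hB hv
  set L := Submodule.span F (Set.range v) with hL
  have hvL : ∀ i, v i ∈ L := fun i => Submodule.subset_span ⟨i, rfl⟩
  have hLn : finrank F L = n := by
    rw [finrank_span_eq_card (linearIndependent_of_apply_ne_zero hv.2.2), Fintype.card_fin]
  obtain ⟨C, -, hC⟩ := hμ.exists_eq_mul_prod φ L hvL fun w i hw hi =>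
    φ.map_coord_zero i (hμ.eq_zero_of_mem_span (hw i) hi)
  have hC0 : C ≠ 0 := by
    have := hv.2.2
    rw [hC v hvL hv.1] at this
    exact left_ne_zero_of_mul this
  have hset : {w | w ∈ genericTuples φ B ∧ Submodule.span F (Set.range w) = L}
      = genericTuples φ fun i => L ⊓ B i := by
    ext w
    constructor
    · rintro ⟨⟨h1, h2, h3⟩, h4⟩
      exact ⟨fun i => ⟨h4 ▸ Submodule.subset_span ⟨i, rfl⟩, h1 i⟩,
        fun i j hij h => h2 i j hij h.2, h3⟩
    · rintro ⟨h1, h2, h3⟩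
      exact ⟨⟨fun i => (h1 i).2, fun i j hij h => h2 i j hij ⟨(h1 i).1, h⟩, h3⟩,
        span_eq_of_linearIndependent (linearIndependent_of_apply_ne_zero h3) hLn fun i => (h1 i).1⟩
  rw [hset, ncard_genericTuples_of_eq_mul_prod (hμ.inf hvL) hC0 fun w hw =>
    hC w (fun i => (hw i).1) fun i => (hw i).2]
  refine Finset.prod_congr rfl fun i _ => ?_
  rw [hyperplaneComplCard, hμ.finrank_span_inf hB]

variable {A : Fin n → Submodule F V} {c : schubertVariety A → F}

theorem span_mem_schubertVariety (hA : Monotone A) {v : Fin n → V}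
    (hv : v ∈ genericTuples φ fun i => A i.rev) :
    Submodule.span F (Set.range v) ∈ schubertVariety A := by
  have hB : Antitone fun i : Fin n => A i.rev := fun i j hij => hA (Fin.rev_le_rev.2 hij)
  obtain ⟨μ, hμ⟩ := exists_isAdapted_of_mem_genericTuples hB hv
  refine ⟨by rw [finrank_span_eq_card (linearIndependent_of_apply_ne_zero hv.2.2),
    Fintype.card_fin], fun i => ?_⟩
  have := hμ.finrank_span_inf hB i.rev
  rw [Fin.rev_rev] at this
  rw [this, Fin.val_rev]
  have := i.2
  omega

/-- The word `c` records the values of `φ` at bases of the points of the Schubert variety. -/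
def IsWordOf (φ : V [⋀^Fin n]→ₗ[F] F) (c : schubertVariety A → F) : Prop :=
  ∀ L : schubertVariety A, ∃ w : Fin n → V, (∀ i, w i ∈ A i.rev) ∧ LinearIndependent F w ∧
    Submodule.span F (Set.range w) = L ∧ c L = φ w

theorem ncard_genericTuples_eq_sum (hA : Monotone A) (hc : IsWordOf φ c) :
    (genericTuples φ fun i => A i.rev).ncard =
      ∑ L ∈ (Set.toFinite {L | c L ≠ 0}).toFinset,
        {v | v ∈ genericTuples φ (fun i => A i.rev) ∧
          Submodule.span F (Set.range v) = L}.ncard := by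
  classical
  rw [ncard_eq_sum_ncard_fiber (f := fun v => Submodule.span F (Set.range v))
    (t := (Set.toFinite {L | c L ≠ 0}).toFinset.image Subtype.val),
    Finset.sum_image Subtype.val_injective.injOn]
  intro v hv
  refine Finset.mem_image.2 ⟨⟨_, span_mem_schubertVariety hA hv⟩, ?_, rfl⟩
  rw [Set.Finite.mem_toFinset]
  obtain ⟨w, -, hw, hwv, hcw⟩ := hc ⟨_, span_mem_schubertVariety hA hv⟩
  rw [Set.mem_ofPred_eq, hcw]
  exact apply_ne_zero_of_span_eq hv.2.2 hw hwv

/-- Only an inequality: a point with nonzero coordinate may have no generic basis. -/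
theorem ncard_genericTuples_le (hA : Monotone A) (hc : IsWordOf φ c) :
    (genericTuples φ fun i => A i.rev).ncard ≤ weight c * adaptedBasesCard F n := by
  rw [ncard_genericTuples_eq_sum hA hc, weight,
    Set.ncard_eq_toFinset_card {L | c L ≠ 0} (Set.toFinite _), ← smul_eq_mul]
  refine Finset.sum_le_card_nsmul _ _ _ fun L _ => ?_
  rcases Set.eq_empty_or_nonempty {v | v ∈ genericTuples φ (fun i => A i.rev) ∧
          Submodule.span F (Set.range v) = L} with h | ⟨v, hv, hvL⟩
  · rw [h, Set.ncard_empty]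
    exact Nat.zero_le _
  · rw [← hvL]
    exact (ncard_genericTuples_span_eq (fun i j hij => hA (Fin.rev_le_rev.2 hij)) hv).le

/-- For a product form, the basis attached to a point with nonzero coordinate is itself generic: an
entry in a smaller flag member would kill a factor. So no fibre is empty. -/
theorem weight_mul_of_eq_mul_prod (hA : Monotone A) (hc : IsWordOf φ c) {μ : Fin n → Dual F V}
    {u : Fin n → V} (h : IsAdapted (fun i => A i.rev) μ u) {t : F} (ht : t ≠ 0)
    (hφ : ∀ v, (∀ i, v i ∈ A i.rev) → φ v = t * ∏ i, μ i (v i)) :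
    weight c * adaptedBasesCard F n = ∏ i : Fin n, hyperplaneComplCard (A i.rev) := by
  rw [← ncard_genericTuples_of_eq_mul_prod h ht hφ, ncard_genericTuples_eq_sum hA hc, weight,
    Set.ncard_eq_toFinset_card {L | c L ≠ 0} (Set.toFinite _), ← smul_eq_mul]
  refine (Finset.sum_eq_card_nsmul fun L hL => ?_).symm
  obtain ⟨w, hwA, -, hwL, hcw⟩ := hc L
  have hL : c L ≠ 0 := (Set.Finite.mem_toFinset _).1 hL
  rw [hcw] at hL
  rw [← hwL]
  refine ncard_genericTuples_span_eq (fun i j hij => hA (Fin.rev_le_rev.2 hij))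
    ⟨hwA, fun i j hij hj => hL ?_, hL⟩
  rw [hφ w hwA, Finset.prod_eq_zero (Finset.mem_univ i) (h.apply_eq_zero i j hij _ hj), mul_zero]

end Finite

/-! ### Decomposable elements and products of functionals. -/

theorem mem_annihilator {d : ℕ} {f : ⋀[F]^d V} {x : V} :
    x ∈ annihilator f ↔ (f : ExteriorAlgebra F V) * ExteriorAlgebra.ι F x = 0 := Iff.rfl

theorem annihilator_smul {d : ℕ} (f : ⋀[F]^d V) {t : F} (ht : t ≠ 0) :
    annihilator (t • f) = annihilator f := by
  ext x
  rw [mem_annihilator, mem_annihilator, Submodule.coe_smul, smul_mul_assoc, smul_eq_zero,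
    or_iff_right ht]

theorem mem_annihilator_ιMulti {d : ℕ} (w : Fin d → V) (i : Fin d) :
    w i ∈ annihilator (exteriorPower.ιMulti F d w) := by
  have h1 : ExteriorAlgebra.ι F (w i) = ExteriorAlgebra.ιMulti F 1 fun _ => w i := by
    simp [ExteriorAlgebra.ιMulti_apply]
  rw [mem_annihilator, exteriorPower.ιMulti_apply_coe, h1, ExteriorAlgebra.ιMulti_mul_ιMulti]
  refine ExteriorAlgebra.ιMulti_eq_zero_of_not_inj fun hinj => ?_
  have := @hinj (Fin.castAdd 1 i) (Fin.natAdd d 0) (by simp)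
  have := congrArg Fin.val this
  simp at this
  have := i.2
  omega

section Contraction

variable {ℓ d m : ℕ} (b : Basis (Fin m) F V)

/-- The alternating form `v ↦ f ∧ v_1 ∧ ⋯ ∧ v_ℓ`. -/
noncomputable def contraction (ℓ : ℕ) (f : ⋀[F]^d V) : V [⋀^Fin ℓ]→ₗ[F] F :=
  (topForm b ∘ₗ LinearMap.mulLeft F (f : ExteriorAlgebra F V)).compAlternatingMap
    (ExteriorAlgebra.ιMulti F ℓ)

theorem contraction_apply (f : ⋀[F]^d V) (v : Fin ℓ → V) :
    contraction b ℓ f v =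
      topForm b ((f : ExteriorAlgebra F V) * ExteriorAlgebra.ιMulti F ℓ v) := rfl

theorem contraction_smul (t : F) (f : ⋀[F]^d V) (v : Fin ℓ → V) :
    contraction b ℓ (t • f) v = t * contraction b ℓ f v := by
  rw [contraction_apply, contraction_apply, Submodule.coe_smul, smul_mul_assoc, map_smul,
    smul_eq_mul]

theorem contraction_eq_zero (f : ⋀[F]^d V) (v : Fin ℓ → V) (i : Fin ℓ)
    (hv : v i ∈ annihilator f) : contraction b ℓ f v = 0 := by
  obtain ⟨n, rfl⟩ : ∃ n, ℓ = n + 1 := ⟨ℓ - 1, by have := i.2; omega⟩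
  have h0 : ∀ w : Fin (n + 1) → V, w 0 ∈ annihilator f → contraction b (n + 1) f w = 0 := by
    intro w hw
    rw [contraction_apply, ExteriorAlgebra.ιMulti_succ_apply, ← mul_assoc, mem_annihilator.1 hw,
      zero_mul, map_zero]
  by_cases hi : 0 = i
  · exact h0 v (hi ▸ hv)
  · have := (contraction b (n + 1) f).map_swap v hi
    rw [← neg_eq_zero, ← this]
    exact h0 _ (by simpa using hv)

theorem contraction_ιMulti_ne_zero (hm : d + ℓ = m) {w : Fin d → V} {u : Fin ℓ → V}
    (h : LinearIndependent F (Fin.append w u)) :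
    contraction b ℓ (exteriorPower.ιMulti F d w) u ≠ 0 := by
  subst hm
  rw [contraction_apply, exteriorPower.ιMulti_apply_coe, ExteriorAlgebra.ιMulti_mul_ιMulti, topForm,
    ExteriorAlgebra.liftAlternating_apply_ιMulti, Pi.single_eq_same]
  have := b.finiteDimensional_of_finite
  have hb := (Basis.is_basis_iff_det b).1 ⟨h, h.span_eq_top_of_card_eq_finrank' (by
    rw [finrank_eq_card_basis b])⟩
  exact hb.ne_zero

variable {b}

theorem IsAdapted.finrank_iInf_ker (b : Basis (Fin m) F V) (hm : d + ℓ = m)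
    {B : Fin ℓ → Submodule F V} {μ : Fin ℓ → Dual F V} {u : Fin ℓ → V} (h : IsAdapted B μ u) :
    finrank F ↥(⨅ i, LinearMap.ker (μ i)) = d := by
  have := b.finiteDimensional_of_finite
  have h1 := LinearMap.finrank_range_add_finrank_ker (LinearMap.pi μ)
  have h2 : LinearMap.range (LinearMap.pi μ) = ⊤ := LinearMap.range_eq_top.2 fun y => by
    obtain ⟨x, -, hx⟩ := h.exists_mem_span y
    exact ⟨x, funext hx⟩
  rw [h2, finrank_top, Module.finrank_pi, Fintype.card_fin, finrank_eq_card_basis b,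
    Fintype.card_fin, LinearMap.ker_pi] at h1
  omega

/-- The wedge product of a basis of the common kernel of the `μ i` is, up to a nonzero scalar,
dual to the wedge product of the `μ i`. -/
theorem IsAdapted.contraction_ιMulti (b : Basis (Fin m) F V) (hm : d + ℓ = m)
    {B : Fin ℓ → Submodule F V} {μ : Fin ℓ → Dual F V} {u : Fin ℓ → V} (h : IsAdapted B μ u)
    {w : Fin d → V} (hw : LinearIndependent F w) (hwμ : ∀ k i, μ i (w k) = 0) :
    annihilator (exteriorPower.ιMulti F d w) = (⨅ i, LinearMap.ker (μ i)) ∧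
      ∃ C : F, C ≠ 0 ∧ ∀ v : Fin ℓ → V, (∀ i, v i ∈ B i) →
        contraction b ℓ (exteriorPower.ιMulti F d w) v = C * ∏ i, μ i (v i) := by
  have := b.finiteDimensional_of_finite
  set f := exteriorPower.ιMulti F d w
  have hspan : Submodule.span F (Set.range w) = ⨅ i, LinearMap.ker (μ i) :=
    span_eq_of_linearIndependent hw (h.finrank_iInf_ker b hm) fun k =>
      (Submodule.mem_iInf _).2 fun i => hwμ k i
  have hle : (⨅ i, LinearMap.ker (μ i)) ≤ annihilator f := by
    rw [← hspan, Submodule.span_le]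
    rintro _ ⟨k, rfl⟩
    exact mem_annihilator_ιMulti w k
  obtain ⟨C, hdet, hC⟩ := h.exists_eq_mul_prod (contraction b ℓ f) ⊤ (fun _ => trivial)
    fun v i _ hv => contraction_eq_zero b f v i (hle ((Submodule.mem_iInf _).2 hv))
  have hC0 : C ≠ 0 := by
    have hli : LinearIndependent F (Fin.append w u) := by
      have hdisj : Disjoint (Submodule.span F (Set.range w)) (Submodule.span F (Set.range u)) := by
        rw [Submodule.disjoint_def]
        intro x hx hxu
        rw [hspan] at hx
        exact h.eq_zero_of_mem_span hxu fun i => (Submodule.mem_iInf _).1 hx i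
      have hu : LinearIndependent F u := by
        have h1 : Matrix.detRowAlternating (R := F) (fun j i => μ i (u j)) ≠ 0 := by
          have := h.det_ne_zero
          rwa [← Matrix.det_transpose] at this
        exact (linearIndependent_of_apply_ne_zero h1).of_comp (LinearMap.pi μ)
      have := hw.sum_type hu hdisj
      rw [← linearIndependent_equiv finSumFinEquiv]
      have heq : Fin.append w u ∘ finSumFinEquiv = Sum.elim w u := by
        ext x
        rcases x with x | x <;> simp
      rwa [heq]
    have := contraction_ιMulti_ne_zero b hm hli
    rw [hC u (fun _ => trivial) h.mem] at this
    exact left_ne_zero_of_mul this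
  refine ⟨le_antisymm (fun x hx => (Submodule.mem_iInf _).2 fun i => ?_) hle, C, hC0,
    fun v hv => hC v (fun _ => trivial) hv⟩
  -- Here `e` is dual to `μ`. Putting `x` in place of `e i` gives the identity matrix with column
  -- `i` replaced, of determinant `μ i x`; the form vanishes there, so `μ i x = 0`.
  choose e _ he using fun j => h.exists_mem_span (Pi.single j 1)
  have h1 := hdet (Function.update e i x) fun _ => trivial
  rw [contraction_eq_zero b f _ i (by simpa using hx)] at h1
  have h2 : (Matrix.of fun a c => μ a (Function.update e i x c))
      = (1 : Matrix (Fin ℓ) (Fin ℓ) F).updateCol i fun a => μ a x := by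
    ext a c
    by_cases hc : c = i
    · subst hc
      simp
    · simp [hc, he, Matrix.one_apply, Pi.single_apply]
  rw [h2, ← Matrix.cramer_apply, Matrix.cramer_one] at h1
  exact (mul_eq_zero.1 h1.symm).resolve_left hC0

/-- The contraction of a Schubert decomposable element is a product of functionals adapted to the
flag. -/
theorem exists_isAdapted_of_finrank_annihilator (b : Basis (Fin m) F V) (hm : d + ℓ = m)
    {A : Fin ℓ → Submodule F V} (hA : Monotone A) {f : ⋀[F]^d V} (hf : IsDecomposable f)
    (hdim : ∀ i, finrank F ↥(annihilator f ⊓ A i) + ((i : ℕ) + 1) = finrank F (A i)) :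
    ∃ (μ : Fin ℓ → Dual F V) (u : Fin ℓ → V) (C : F), IsAdapted (fun i => A i.rev) μ u ∧ C ≠ 0 ∧
      ∀ v : Fin ℓ → V, (∀ i, v i ∈ A i.rev) → contraction b ℓ f v = C * ∏ i, μ i (v i) := by
  have := b.finiteDimensional_of_finite
  obtain ⟨hf0, w, rfl⟩ := hf
  set W := annihilator (exteriorPower.ιMulti F d w) with hW
  have hw : LinearIndependent F w := by
    by_contra hw
    exact hf0 ((exteriorPower.ιMulti F d).map_linearDependent w hw)
  obtain ⟨μ, u, hμ, hWμ⟩ := exists_isAdapted_of_not_le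
    (B := fun i => A i.rev) (fun i j hij => hA (Fin.rev_le_rev.2 hij)) W
    (fun i hi => by
      have := hdim i.rev
      rw [inf_eq_right.2 hi] at this
      omega)
    -- The hypothesis amounts to `dim (W ⊔ A k) = dim W + k + 1` (zero-based `k`), so distinct
    -- indices cannot give the same sum.
    (fun i j hij hi => by
      have hij' : j.rev < i.rev := Fin.rev_lt_rev.2 hij
      have h1 : W ⊔ A i.rev = W ⊔ A j.rev :=
        le_antisymm (sup_le le_sup_left hi) (sup_le_sup_left (hA hij'.le) _)
      have h2 := Submodule.finrank_sup_add_finrank_inf_eq W (A i.rev)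
      have h3 := Submodule.finrank_sup_add_finrank_inf_eq W (A j.rev)
      have h4 := hdim i.rev
      have h5 := hdim j.rev
      have h6 : (j.rev : ℕ) < i.rev := hij'
      rw [h1] at h2
      omega)
  obtain ⟨-, C, hC, hprod⟩ := hμ.contraction_ιMulti b hm hw fun k i =>
    hWμ i (mem_annihilator_ιMulti w k)
  exact ⟨μ, u, C, hμ, hC, hprod⟩

/-- Take the wedge of a basis of `⋂ ker μ i`, whose annihilator is that same intersection. The
scalar is absorbed into the first vector, which is where `0 < d` is needed. -/
theorem IsAdapted.exists_isSchubertDecomposable (b : Basis (Fin m) F V) (hm : d + ℓ = m)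
    (hd : 0 < d) {A : Fin ℓ → Submodule F V} (hA : Monotone A) {μ : Fin ℓ → Dual F V}
    {u : Fin ℓ → V} (h : IsAdapted (fun i => A i.rev) μ u) {c : F} (hc : c ≠ 0) :
    ∃ f : ⋀[F]^d V, IsSchubertDecomposable A f ∧
      ∀ v : Fin ℓ → V, (∀ i, v i ∈ A i.rev) → contraction b ℓ f v = c * ∏ i, μ i (v i) := by
  have := b.finiteDimensional_of_finite
  set e := finBasisOfFinrankEq F _ (h.finrank_iInf_ker b hm) with he
  set w : Fin d → V := fun k => e k with hwdef
  have hw : LinearIndependent F w :=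
    e.linearIndependent.map' (Submodule.subtype _) (Submodule.ker_subtype _)
  obtain ⟨hann, C, hC, hprod⟩ := h.contraction_ιMulti b hm hw fun k i =>
    (Submodule.mem_iInf _).1 (e k).2 i
  have hne : exteriorPower.ιMulti F d w ≠ 0 := by
    intro h0
    have := hprod u h.mem
    rw [h0, contraction_apply, Submodule.coe_zero, zero_mul, map_zero] at this
    exact mul_ne_zero hC (Finset.prod_ne_zero_iff.2 fun i _ => h.apply_ne_zero i) this.symm
  have ht : c * C⁻¹ ≠ 0 := mul_ne_zero hc (inv_ne_zero hC)
  refine ⟨(c * C⁻¹) • exteriorPower.ιMulti F d w, ⟨⟨smul_ne_zero ht hne,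
    Function.update w ⟨0, hd⟩ ((c * C⁻¹) • w ⟨0, hd⟩), ?_⟩, fun i _ => ?_⟩, fun v hv => ?_⟩
  · rw [AlternatingMap.map_update_smul, Function.update_eq_self]
  · have h1 := h.finrank_iInf_ker_inf (fun i j hij => hA (Fin.rev_le_rev.2 hij)) i.rev
    rw [card_subtype_fin_le, Fin.rev_rev, Fin.val_rev] at h1
    rw [annihilator_smul _ ht, hann, dimSeq, ← h1]
    have := i.2
    omega
  · rw [contraction_smul, hprod v hv]
    field_simp

end Contraction

/-! ### Codewords and the minimum distance. -/

section Evaluation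

variable {ℓ m : ℕ} {b : Basis (Fin m) F V} {A : Fin ℓ → Submodule F V}
  {P : schubertVariety A → ⋀[F]^ℓ V}

theorem IsRepresentatives.exists_basis [FiniteDimensional F V] (hP : IsRepresentatives A P)
    (L : schubertVariety A) :
    ∃ w : Fin ℓ → V, (∀ i, w i ∈ A i.rev) ∧ LinearIndependent F w ∧
      Submodule.span F (Set.range w) = L ∧ P L = exteriorPower.ιMulti F ℓ w := by
  obtain ⟨h0, ⟨v, hv, hPv⟩, hL⟩ := hP L
  have hw : LinearIndependent F fun i : Fin ℓ => v i.rev := by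
    by_contra hw
    exact h0 (hPv.trans ((exteriorPower.ιMulti F ℓ).map_linearDependent _ hw))
  refine ⟨fun i => v i.rev, fun i => hv i.rev, hw,
    span_eq_of_linearIndependent hw L.2.1 fun i => ?_, hPv⟩
  rw [← hL, hPv]
  exact mem_annihilator_ιMulti (fun i : Fin ℓ => v i.rev) i

theorem evaluation_apply_eq {L : schubertVariety A} {w : Fin ℓ → V}
    (hw : P L = exteriorPower.ιMulti F ℓ w) (f : ⋀[F]^(m - ℓ) V) :
    evaluation b A P f L = contraction b ℓ f w := by
  rw [contraction_apply, ← exteriorPower.ιMulti_apply_coe, ← hw]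
  rfl

theorem isWordOf_evaluation [FiniteDimensional F V] (hP : IsRepresentatives A P)
    (f : ⋀[F]^(m - ℓ) V) : IsWordOf (contraction b ℓ f) (evaluation b A P f) := fun L => by
  obtain ⟨w, h1, h2, h3, h4⟩ := hP.exists_basis L
  exact ⟨w, h1, h2, h3, evaluation_apply_eq h4 f⟩

/-- Coordinates only see tuples from the flag, so the decomposable representative of a codeword may
differ from the original element. -/
theorem evaluation_eq_of_contraction_eq [FiniteDimensional F V] (hP : IsRepresentatives A P)
    {f g : ⋀[F]^(m - ℓ) V}
    (h : ∀ v : Fin ℓ → V, (∀ i, v i ∈ A i.rev) → contraction b ℓ f v = contraction b ℓ g v) :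
    evaluation b A P f = evaluation b A P g := by
  ext L
  obtain ⟨w, h1, -, -, h4⟩ := hP.exists_basis L
  rw [evaluation_apply_eq h4, evaluation_apply_eq h4, h w h1]

end Evaluation

section Finite

variable {ℓ m : ℕ} {b : Basis (Fin m) F V} {A : Fin ℓ → Submodule F V}
  {P : schubertVariety A → ⋀[F]^ℓ V}

theorem isBlockEnd_of_isCompletelyNonconsecutive {α : Fin ℓ → ℕ}
    (hα : IsCompletelyNonconsecutive α) (i : Fin ℓ) : IsBlockEnd α i := by
  by_cases hi : (i : ℕ) + 1 < ℓ
  · exact Or.inr ⟨⟨i + 1, hi⟩, rfl, hα _ _ rfl⟩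
  · exact Or.inl (by have := i.2; omega)

theorem weight_of_isSchubertDecomposable [Finite V] (hℓm : ℓ < m) (hA : Monotone A)
    (hα : IsCompletelyNonconsecutive (dimSeq A)) (hP : IsRepresentatives A P)
    {f : ⋀[F]^(m - ℓ) V} (hf : IsSchubertDecomposable A f) :
    weight (evaluation b A P f) * adaptedBasesCard F ℓ
      = ∏ i : Fin ℓ, hyperplaneComplCard (A i.rev) := by
  obtain ⟨μ, u, C, hμ, hC, h⟩ := exists_isAdapted_of_finrank_annihilator b
    (Nat.sub_add_cancel hℓm.le) hA hf.1
    fun i => hf.2 i (isBlockEnd_of_isCompletelyNonconsecutive hα i)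
  exact weight_mul_of_eq_mul_prod hA (isWordOf_evaluation hP f) hμ hC h

theorem exists_isSchubertDecomposable (b : Basis (Fin m) F V) (hℓm : ℓ < m) (hA : StrictMono A)
    (hA0 : ∀ i, A i ≠ ⊥) : ∃ f : ⋀[F]^(m - ℓ) V, IsSchubertDecomposable A f := by
  obtain ⟨μ, u, hμ, -⟩ := exists_isAdapted_of_not_le
    (B := fun i => A i.rev) (fun i j hij => hA.monotone (Fin.rev_le_rev.2 hij)) ⊥
    (fun i hi => hA0 _ (le_bot_iff.1 hi))
    (fun i j hij hi => by
      rw [bot_sup_eq] at hi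
      exact absurd (hA (Fin.rev_lt_rev.2 hij)) (not_lt_of_ge hi))
  obtain ⟨f, hf, -⟩ := hμ.exists_isSchubertDecomposable b (Nat.sub_add_cancel hℓm.le)
    (Nat.sub_pos_of_lt hℓm) hA.monotone one_ne_zero
  exact ⟨f, hf⟩

variable [Finite F]

theorem adaptedBasesCard_pos (n : ℕ) : 0 < adaptedBasesCard F n :=
  Finset.prod_pos fun i _ => Nat.sub_pos_of_lt <|
    Nat.pow_lt_pow_right one_lt_card (by have := i.2; omega)

/-- The number of generic tuples lies between the product and the scaled weight; if these agree, the
rigid case of the lower bound supplies the functionals and hence `h`. -/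
theorem prod_le_weight_mul [Finite V] (hℓm : ℓ < m) (hA : Monotone A)
    (hα : IsCompletelyNonconsecutive (dimSeq A)) (hP : IsRepresentatives A P)
    {f : ⋀[F]^(m - ℓ) V} (hf : evaluation b A P f ≠ 0) :
    ∏ i : Fin ℓ, hyperplaneComplCard (A i.rev) ≤
        weight (evaluation b A P f) * adaptedBasesCard F ℓ ∧
      (weight (evaluation b A P f) * adaptedBasesCard F ℓ ≤
          ∏ i : Fin ℓ, hyperplaneComplCard (A i.rev) →
        ∃ h, IsSchubertDecomposable A h ∧ evaluation b A P f = evaluation b A P h) := by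
  have hgap : ∀ i j : Fin ℓ, (j : ℕ) = i + 1 →
      finrank F (A j.rev) + 2 ≤ finrank F (A i.rev) := fun i j hij =>
    hα _ _ (by rw [Fin.val_rev, Fin.val_rev]; have := j.2; omega)
  have hne : ∃ v : Fin ℓ → V, (∀ i, v i ∈ A i.rev) ∧ contraction b ℓ f v ≠ 0 := by
    obtain ⟨L, hL⟩ := Function.ne_iff.1 hf
    obtain ⟨w, h1, -, -, h4⟩ := isWordOf_evaluation hP f L
    exact ⟨w, h1, h4 ▸ hL⟩
  have hle := ncard_genericTuples_le hA (isWordOf_evaluation (b := b) hP f)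
  obtain ⟨h1, h2⟩ := prod_le_ncard_genericTuples (fun i => A i.rev)
    (fun i j hij => hA (Fin.rev_le_rev.2 hij)) hgap _ hne
  refine ⟨h1.trans hle, fun h => ?_⟩
  obtain ⟨μ, u, c, hμ, hc, hprod⟩ := h2 (hle.trans h)
  obtain ⟨g, hg, hgprod⟩ := hμ.exists_isSchubertDecomposable b (Nat.sub_add_cancel hℓm.le)
    (Nat.sub_pos_of_lt hℓm) hA hc
  exact ⟨g, hg, evaluation_eq_of_contraction_eq hP fun v hv => by rw [hprod v hv, hgprod v hv]⟩

theorem minimumDistance_mul [Finite V] (hℓm : ℓ < m) (hA : StrictMono A) (hA0 : ∀ i, A i ≠ ⊥)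
    (hα : IsCompletelyNonconsecutive (dimSeq A)) (hP : IsRepresentatives A P) :
    minimumDistance (schubertCode b A P) * adaptedBasesCard F ℓ
      = ∏ i : Fin ℓ, hyperplaneComplCard (A i.rev) := by
  obtain ⟨f, hf⟩ := exists_isSchubertDecomposable b hℓm hA hA0
  have hw := weight_of_isSchubertDecomposable (b := b) hℓm hA.monotone hα hP hf
  have hpos : 0 < ∏ i : Fin ℓ, hyperplaneComplCard (A i.rev) :=
    Finset.prod_pos fun i _ => hyperplaneComplCard_pos (hA0 _)
  have hmem : weight (evaluation b A P f) ∈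
      {w | ∃ c ∈ schubertCode b A P, c ≠ 0 ∧ weight c = w} := by
    refine ⟨_, ⟨f, rfl⟩, fun h0 => ?_, rfl⟩
    rw [h0] at hw
    simp only [weight, Pi.zero_apply, ne_eq, not_true_eq_false, Set.ofPred_false, Set.ncard_empty,
      zero_mul] at hw
    omega
  refine le_antisymm (hw ▸ Nat.mul_le_mul_right _ (Nat.sInf_le hmem)) ?_
  obtain ⟨_, ⟨g, rfl⟩, hg0, hg⟩ := Nat.sInf_mem ⟨_, hmem⟩
  rw [minimumDistance, ← hg]
  exact (prod_le_weight_mul hℓm hA.monotone hα hP hg0).1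

end Finite

end SchubertCode

theorem corollary6p2 {F V : Type*} [Field F] [Finite F] [AddCommGroup V] [Module F V]
    {ℓ m : ℕ} (hℓ : 1 ≤ ℓ) (hℓm : ℓ < m) (b : Module.Basis (Fin m) F V)
    (A : Fin ℓ → Submodule F V) (hA : StrictMono A) (hA0 : ∀ i, A i ≠ ⊥)
    (hα : SchubertCode.IsCompletelyNonconsecutive (SchubertCode.dimSeq A))
    (P : SchubertCode.schubertVariety A → ⋀[F]^ℓ V)
    (hP : SchubertCode.IsRepresentatives A P)
    (c : SchubertCode.schubertVariety A → F) (hc : c ∈ SchubertCode.schubertCode b A P) :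
    SchubertCode.weight c = SchubertCode.minimumDistance (SchubertCode.schubertCode b A P) ↔
      ∃ h : ⋀[F]^(m - ℓ) V, SchubertCode.IsSchubertDecomposable A h ∧
        c = SchubertCode.evaluation b A P h := by
  have := b.finiteDimensional_of_finite
  have : Finite V := Module.finite_of_finite F
  have hmin := SchubertCode.minimumDistance_mul (b := b) hℓm hA hA0 hα hP
  constructor
  · intro hw
    rw [← hw] at hmin
    obtain ⟨f, rfl⟩ := hc
    refine (SchubertCode.prod_le_weight_mul hℓm hA.monotone hα hP fun h0 => ?_).2 hmin.le
    -- The zero word is excluded: its weight is 0, while the scaled minimum distance is a positive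
    -- product.
    have hpos : 0 < ∏ i : Fin ℓ, SchubertCode.hyperplaneComplCard (A i.rev) :=
      Finset.prod_pos fun i _ => SchubertCode.hyperplaneComplCard_pos (hA0 _)
    rw [h0] at hmin
    simp only [SchubertCode.weight, Pi.zero_apply, ne_eq, not_true_eq_false, Set.ofPred_false,
      Set.ncard_empty, zero_mul] at hmin
    omega
  · rintro ⟨h, hh, rfl⟩
    refine Nat.eq_of_mul_eq_mul_right (SchubertCode.adaptedBasesCard_pos (F := F) ℓ) ?_
    rw [hmin, SchubertCode.weight_of_isSchubertDecomposable hℓm hA.monotone hα hP hh]
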